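/- Let $n\ge 0$ and let $\mathcal F_n$ be the group with generators $\zeta_1,\dots,\zeta_{n-1},\tau_1,\dots,\tau_{n-1}$ and relations 1. $\tau_i^2=1$, $\zeta_i^2=1$; 2. $\tau_i\zeta_i=\zeta_i\tau_i$; 3. $\zeta_i\zeta_j=\zeta_j\zeta_i$, $\zeta_i\tau_j=\tau_j\zeta_i$, $\tau_i\tau_j=\tau_j\tau_i$ for $|i-j|\ge 2$; 4. $\tau_i\tau_{i+1}\tau_i=\tau_{i+1}\tau_i\tau_{i+1}$ for $1\le i\le n-2$; 5. $\tau_i\tau_{i+1}\zeta_i=\zeta_{i+1}\tau_i\tau_{i+1}$ for $1\le i\le n-2$. A *braid-word* is a finite word in the letters $\zeta_i,\tau_i$ (without inverses). Two braid-words are *strongly equivalent* if one can be obtained from the other by finitely many replacements of a subword by means of the relations (1)–(5), in either direction, except the relations $\zeta_i^2=1$. A braid-word is drawn as a diagram of $n$ descending strands, read from top to bottom, in which a letter $\zeta_i$ (a *classical crossing*) or $\tau_i$ (a *virtual crossing*) makes the strands currently in positions $i$ and $i+1$ cross; strands are numbered by the positions of their upper ends. Two distinct classical crossings $x,x'$ of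 a braid-word $\beta$ *form a bigon* if the same two strands pass through $x$ and through $x'$, and no classical crossing strictly between $x$ and $x'$ in $\beta$ lies on either of these two strands. A *bigon reduction* deletes the two letters $x,x'$ from $\beta$. A braid-word is *irreducible* if it admits no bigon reduction. **Theorem.** Every element $b$ of $\mathcal F_n$ is represented by an irreducible braid-word, and any two irreducible braid-words representing $b$ are strongly equivalent. -/

import Mathlib

namespace FreeBraid

/-- The letters `ζ_i`, `τ_i` (`n - 1` of each kind, indexed from `0`). -/
inductive Letter (n : ℕ) where
  | zeta (i : Fin (n - 1)) : Letter n
  | tau (i : Fin (n - 1)) : Letter n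

/-- An `n`-strand braid-word: a word in the letters `ζ_i`, `τ_i` (no formal inverses). -/
abbrev Word (n : ℕ) := List (Letter n)

open Letter

/-- The defining relations `p = q` of `F_n` other than `ζ_i² = 1`. -/
inductive StrongRel {n : ℕ} : Word n → Word n → Prop
  | tau_sq (i : Fin (n - 1)) : StrongRel [tau i, tau i] []
  | virtualization (i : Fin (n - 1)) : StrongRel [tau i, zeta i] [zeta i, tau i]
  | far_zeta_zeta (i j : Fin (n - 1)) (h : i.val + 2 ≤ j.val ∨ j.val + 2 ≤ i.val) :
      StrongRel [zeta i, zeta j] [zeta j, zeta i]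
  | far_zeta_tau (i j : Fin (n - 1)) (h : i.val + 2 ≤ j.val ∨ j.val + 2 ≤ i.val) :
      StrongRel [zeta i, tau j] [tau j, zeta i]
  | far_tau_tau (i j : Fin (n - 1)) (h : i.val + 2 ≤ j.val ∨ j.val + 2 ≤ i.val) :
      StrongRel [tau i, tau j] [tau j, tau i]
  | virtual_three (i j : Fin (n - 1)) (h : j.val = i.val + 1) :
      StrongRel [tau i, tau j, tau i] [tau j, tau i, tau j]
  | semivirtual_three (i j : Fin (n - 1)) (h : j.val = i.val + 1) :
      StrongRel [tau i, tau j, zeta i] [zeta j, tau i, tau j]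

/-- All the defining relations `p = q` of `F_n`. -/
inductive DefRel {n : ℕ} : Word n → Word n → Prop
  | strong {p q : Word n} (h : StrongRel p q) : DefRel p q
  | zeta_sq (i : Fin (n - 1)) : DefRel [zeta i, zeta i] []

/-- The relators `p q⁻¹` in the free group on the letters. -/
def relators (n : ℕ) : Set (FreeGroup (Letter n)) :=
  {r | ∃ p q : Word n, DefRel p q ∧
    r = (p.map FreeGroup.of).prod * ((q.map FreeGroup.of).prod)⁻¹}

/-- The group `F_n`, given by generators and relations. -/
abbrev F (n : ℕ) := PresentedGroup (relators n)

/-- The element of `F_n` represented by a braid-word. -/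
def Word.toF {n : ℕ} (β : Word n) : F n :=
  (β.map (fun g => (PresentedGroup.of g : F n))).prod

/-- One application of a relation of `F_n` other than `ζ_i² = 1` inside a word. -/
def StrongMove {n : ℕ} (β β' : Word n) : Prop :=
  ∃ A B p q : Word n, StrongRel p q ∧ β = A ++ p ++ B ∧ β' = A ++ q ++ B

/-- Strong equivalence: finitely many moves, each in either direction. -/
def StronglyEquivalent {n : ℕ} (β β' : Word n) : Prop :=
  Relation.EqvGen StrongMove β β'

/-- The left position of the two positions crossed by a letter with index `i`. -/
def leftPos {n : ℕ} (i : Fin (n - 1)) : Fin n := ⟨i.val, by omega⟩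

/-- The right position of the two positions crossed by a letter with index `i`. -/
def rightPos {n : ℕ} (i : Fin (n - 1)) : Fin n := ⟨i.val + 1, by omega⟩

/-- Both `ζ_i` and `τ_i` interchange the strands in two neighbouring positions. -/
def Letter.swap {n : ℕ} : Letter n → Equiv.Perm (Fin n)
  | zeta i => Equiv.swap (leftPos i) (rightPos i)
  | tau i => Equiv.swap (leftPos i) (rightPos i)

/-- `strandAt A p` is the number of the strand which is in position `p` below the diagram of `A`,
when words are read from the top to the bottom and strands are numbered by their upper ends.
Indeed `strandAt [] p = p`, and appending a letter `g` to `A` replaces `strandAt A` by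
`strandAt A ∘ g.swap`. -/
def strandAt {n : ℕ} (A : Word n) : Equiv.Perm (Fin n) :=
  (A.map Letter.swap).prod

/-- The two strands (numbered by their upper ends) that meet at the `k`-th letter of `β`,
if this letter has index `i`. -/
def crossingStrands {n : ℕ} (β : Word n) (k : ℕ) (i : Fin (n - 1)) : Finset (Fin n) :=
  {strandAt (β.take k) (leftPos i), strandAt (β.take k) (rightPos i)}

/-- The letters of `β` number `k < l` (counted from `0`) are classical crossings which form a
bigon: the same two strands meet in both, and no classical crossing between them lies on either
of these two strands. -/
def FormBigon {n : ℕ} (β : Word n) (k l : ℕ) : Prop :=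
  k < l ∧ ∃ i j : Fin (n - 1), β[k]? = some (zeta i) ∧ β[l]? = some (zeta j) ∧
    crossingStrands β k i = crossingStrands β l j ∧
    ∀ m : ℕ, k < m → m < l → ∀ t : Fin (n - 1), β[m]? = some (zeta t) →
      Disjoint (crossingStrands β m t) (crossingStrands β k i)

/-- `β'` is obtained from `β` by deleting two classical crossings that form a bigon. -/
def BigonReduction {n : ℕ} (β β' : Word n) : Prop :=
  ∃ k l : ℕ, FormBigon β k l ∧ β' = (β.eraseIdx l).eraseIdx k

/-- A braid-word is irreducible if it admits no bigon reduction. -/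
def IrreducibleWord {n : ℕ} (β : Word n) : Prop :=
  ¬ ∃ β' : Word n, BigonReduction β β'

end FreeBraid

/-! A braid-word has two invariants: its permutation `strandAt`, and the list `edgesFrom 1` of
unordered pairs of strands meeting at its successive classical crossings. A strong relation keeps
the permutation and at most exchanges adjacent disjoint pairs in the list; `ζ_i² = 1` inserts or
deletes two adjacent equal pairs. So elements of `F_n` can be compared in a right-angled Coxeter
group, generated by pairs of strands with disjoint pairs commuting, extended by the symmetric group.

A bigon is a pattern `e Y e` in the list with every pair in `Y` disjoint from `e`
(`formBigon_append_iff`). Hence an irreducible word has a reduced list, and reduced lists of the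
same element differ only by commutations, because normalization is well defined up to commutations
(`normalize_edgesFrom_traceEq_of_toF_eq`).

Conversely, the two invariants determine the strong class. The `τ_i` generate a copy of the
symmetric group (`exists_section`); a conjugate of `ζ_i τ_i` by a permutation depends only on the
pair of strands that cross (`permConj_pureCrossing_eq`), and such conjugates commute for disjoint
pairs (`crossingOf_mul_comm`). A word is thus the product of the crossings in its list, times its
permutation (`wordClass_eq_prod`). The same factorization shows that a bigon reduction preserves the
element of `F_n`; as it shortens the word, irreducible representatives exist. -/

namespace FreeBraid

open Letter

/-! ### Reduced words in right-angled Coxeter groups -/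

section Trace

variable {E : Type*} {I : E → E → Prop}

/-- Equivalence of lists generated by exchanging adjacent independent letters. -/
inductive TraceEq (I : E → E → Prop) : List E → List E → Prop
  | nil : TraceEq I [] []
  | cons (a : E) {u v : List E} (h : TraceEq I u v) : TraceEq I (a :: u) (a :: v)
  | swap (a b : E) (u : List E) (h : I a b) : TraceEq I (a :: b :: u) (b :: a :: u)
  | trans {u v w : List E} (h : TraceEq I u v) (h' : TraceEq I v w) : TraceEq I u w

theorem TraceEq.refl (u : List E) : TraceEq I u u := by
  induction u with
  | nil => exact .nil
  | cons a u ih => exact .cons a ih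

theorem TraceEq.symm (hI : ∀ a b, I a b → I b a) {u v : List E} (h : TraceEq I u v) :
    TraceEq I v u := by
  induction h with
  | nil => exact .nil
  | cons a _ ih => exact .cons a ih
  | swap a b u h => exact .swap b a u (hI _ _ h)
  | trans _ _ ih ih' => exact ih'.trans ih

open Classical in
/-- Remove the first occurrence of `e`, provided all letters before it are independent of `e`. -/
noncomputable def cancel (I : E → E → Prop) (e : E) : List E → Option (List E)
  | [] => none
  | x :: w => if x = e then some w else if I x e then (cancel I e w).map (x :: ·) else none

/-- Left multiplication by an involution `e` on reduced words of a right-angled Coxeter group. -/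
noncomputable def act (I : E → E → Prop) (e : E) (w : List E) : List E :=
  (cancel I e w).getD (e :: w)

/-- Normalization of a word in a right-angled Coxeter group. -/
noncomputable def normalize (I : E → E → Prop) (w : List E) : List E :=
  w.foldr (act I) []

/-- A list in which no letter can be cancelled. -/
def Reduced (I : E → E → Prop) : List E → Prop
  | [] => True
  | e :: w => cancel I e w = none ∧ Reduced I w

theorem cancel_cons_self (e : E) (w : List E) : cancel I e (e :: w) = some w := by
  simp [cancel]

theorem cancel_cons_of_indep {x e : E} (w : List E) (hne : x ≠ e) (h : I x e) :
    cancel I e (x :: w) = (cancel I e w).map (x :: ·) := by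
  simp [cancel, hne, h]

theorem cancel_cons_of_dep {x e : E} (w : List E) (hne : x ≠ e) (h : ¬ I x e) :
    cancel I e (x :: w) = none := by
  simp [cancel, hne, h]

/-- Cancellation is well defined on commutation classes: for equivalent lists it fails on both, or
succeeds on both with equivalent remainders. -/
theorem TraceEq.cancel (hI : ∀ a b, I a b → I b a) {u v : List E} (h : TraceEq I u v) (e : E) :
    Option.Rel (TraceEq I) (cancel I e u) (cancel I e v) := by
  induction h with
  | nil => exact .none
  | @cons a u v h ih =>
    by_cases hae : a = e
    · subst hae
      simpa [cancel_cons_self] using h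
    by_cases hI' : I a e
    · rw [cancel_cons_of_indep _ hae hI', cancel_cons_of_indep _ hae hI']
      revert ih
      generalize FreeBraid.cancel I e u = x, FreeBraid.cancel I e v = y
      intro ih
      cases ih with
      | none => exact .none
      | some h => exact .some (.cons a h)
    · rw [cancel_cons_of_dep _ hae hI', cancel_cons_of_dep _ hae hI']
      exact .none
  | swap a b u h =>
    -- `I` need not be irreflexive; equal letters give identical lists.
    by_cases hab : a = b
    · subst hab
      cases FreeBraid.cancel I e (a :: a :: u) with
      | none => exact .none
      | some l => exact .some (.refl l)
    by_cases hae : a = e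
    · subst hae
      rw [cancel_cons_self, cancel_cons_of_indep _ (Ne.symm hab) (hI _ _ h), cancel_cons_self]
      exact .some (.refl _)
    by_cases hbe : b = e
    · subst hbe
      rw [cancel_cons_self, cancel_cons_of_indep _ hab h, cancel_cons_self]
      exact .some (.refl _)
    by_cases ha : I a e
    · by_cases hb : I b e
      · rw [cancel_cons_of_indep (b :: u) hae ha, cancel_cons_of_indep u hbe hb,
          cancel_cons_of_indep (a :: u) hbe hb, cancel_cons_of_indep u hae ha]
        cases FreeBraid.cancel I e u with
        | none => exact .none
        | some l => exact .some (.swap _ _ _ h)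
      · rw [cancel_cons_of_indep _ hae ha, cancel_cons_of_dep _ hbe hb,
          cancel_cons_of_dep _ hbe hb]
        exact .none
    · by_cases hb : I b e
      · rw [cancel_cons_of_dep _ hae ha, cancel_cons_of_indep _ hbe hb,
          cancel_cons_of_dep _ hae ha]
        exact .none
      · rw [cancel_cons_of_dep _ hae ha, cancel_cons_of_dep _ hbe hb]
        exact .none
  | @trans u v w _ _ ih ih' =>
    revert ih ih'
    generalize FreeBraid.cancel I e u = x, FreeBraid.cancel I e v = y,
      FreeBraid.cancel I e w = z
    intro ih ih'
    cases ih with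
    | none => exact ih'
    | some h => cases ih' with
      | some h' => exact .some (h.trans h')

theorem TraceEq.cancel_eq_none_iff (hI : ∀ a b, I a b → I b a) {u v : List E}
    (h : TraceEq I u v) (e : E) : FreeBraid.cancel I e u = none ↔ FreeBraid.cancel I e v = none := by
  have := h.cancel hI e
  revert this
  generalize FreeBraid.cancel I e u = x, FreeBraid.cancel I e v = y
  intro h
  cases h <;> simp

theorem TraceEq.act (hI : ∀ a b, I a b → I b a) {u v : List E} (h : TraceEq I u v) (e : E) :
    TraceEq I (act I e u) (act I e v) := by
  have := h.cancel hI e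
  revert this
  unfold FreeBraid.act
  generalize FreeBraid.cancel I e u = x, FreeBraid.cancel I e v = y
  intro h'
  cases h' with
  | none => exact .cons e h
  | some h' => exact h'

theorem TraceEq.reduced_iff (hI : ∀ a b, I a b → I b a) {u v : List E} (h : TraceEq I u v) :
    Reduced I u ↔ Reduced I v := by
  induction h with
  | nil => rfl
  | cons a h ih => exact and_congr (h.cancel_eq_none_iff hI a) ih
  | swap a b u h =>
    by_cases hab : a = b
    · rw [hab]
    · simp only [Reduced]
      rw [cancel_cons_of_indep _ hab h, cancel_cons_of_indep _ (Ne.symm hab) (hI _ _ h)]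
      simp only [Option.map_eq_none_iff]
      tauto
  | trans _ _ ih ih' => exact ih.trans ih'

theorem traceEq_of_cancel_eq_some {e : E} {w w' : List E}
    (h : cancel I e w = some w') : TraceEq I w (e :: w') := by
  induction w generalizing w' with
  | nil => simp [cancel] at h
  | cons x w ih =>
    by_cases hxe : x = e
    · subst hxe
      rw [cancel_cons_self] at h
      cases h
      exact .refl _
    by_cases hx : I x e
    · rw [cancel_cons_of_indep _ hxe hx] at h
      obtain ⟨v, hv, rfl⟩ := Option.map_eq_some_iff.1 h
      exact (TraceEq.cons x (ih hv)).trans (.swap _ _ _ hx)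
    · rw [cancel_cons_of_dep _ hxe hx] at h
      cases h

theorem Reduced.act (hI : ∀ a b, I a b → I b a) {w : List E} (h : Reduced I w) (e : E) :
    Reduced I (act I e w) := by
  unfold FreeBraid.act
  cases hc : cancel I e w with
  | none => exact ⟨hc, h⟩
  | some w' => exact (((traceEq_of_cancel_eq_some hc).reduced_iff hI).1 h).2

theorem reduced_normalize (hI : ∀ a b, I a b → I b a) (w : List E) :
    Reduced I (normalize I w) := by
  induction w with
  | nil => trivial
  | cons e w ih => exact ih.act hI e

theorem act_of_cancel_eq_none {e : E} {w : List E} (h : cancel I e w = none) :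
    act I e w = e :: w := by
  simp [act, h]

theorem act_cons_self (e : E) (w : List E) : act I e (e :: w) = w := by
  simp [act, cancel_cons_self]

theorem Reduced.normalize_eq {w : List E} (h : Reduced I w) : normalize I w = w := by
  induction w with
  | nil => rfl
  | cons e w ih =>
    change FreeBraid.act I e (normalize I w) = _
    rw [ih h.2, act_of_cancel_eq_none h.1]

/-- Reducedness matters when `e` cancels: it rules out a second cancellable `e`, which the second
action would delete instead of restoring the first. -/
theorem act_act_self (hI : ∀ a b, I a b → I b a) {w : List E} (h : Reduced I w) (e : E) :
    TraceEq I (act I e (act I e w)) w := by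
  cases hc : cancel I e w with
  | none => rw [act_of_cancel_eq_none hc, act_cons_self]; exact .refl _
  | some w' =>
    have h1 := traceEq_of_cancel_eq_some hc
    have h2 := ((h1.reduced_iff hI).1 h).1
    refine ((h1.act hI e).act hI e).trans ?_
    rw [act_cons_self, act_of_cancel_eq_none h2]
    exact h1.symm hI

theorem act_act_comm (hI : ∀ a b, I a b → I b a) {e f : E} (h : I e f) (w : List E) :
    TraceEq I (act I e (act I f w)) (act I f (act I e w)) := by
  by_cases hef : e = f
  · subst hef; exact .refl _
  have h' := hI _ _ h
  -- The mixed case, where only one of the two letters cancels; it serves both orders of `e` and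
  -- `f`.
  have one_side : ∀ {e f : E}, e ≠ f → I e f → ∀ u, cancel I f u = none →
      TraceEq I (act I e (act I f (e :: u))) (act I f (act I e (e :: u))) := by
    intro e f hef h u hu
    have h' := hI _ _ h
    rw [act_cons_self, act_of_cancel_eq_none hu, act_of_cancel_eq_none (e := f),
      show act I e (f :: e :: u) = f :: u by
        simp [act, cancel_cons_of_indep _ hef.symm h', cancel_cons_self]]
    · exact .refl _
    · rw [cancel_cons_of_indep _ hef h, hu]; rfl
  -- The claim is invariant under commutations of `w`, so a cancellable letter may be assumed to
  -- stand in front.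
  have transfer : ∀ {e f : E} {u : List E}, TraceEq I w u →
      TraceEq I (act I e (act I f u)) (act I f (act I e u)) →
      TraceEq I (act I e (act I f w)) (act I f (act I e w)) := fun hu hc =>
    (((hu.act hI _).act hI _).trans hc).trans (((hu.act hI _).act hI _).symm hI)
  cases he : cancel I e w with
  | some u =>
    have h1 := traceEq_of_cancel_eq_some he
    refine transfer h1 ?_
    cases hf : cancel I f u with
    | none => exact one_side hef h u hf
    | some v =>
      rw [act_cons_self, show act I f (e :: u) = e :: v by
        simp [act, cancel_cons_of_indep _ hef h, hf], act_cons_self,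
        show act I f u = v by simp [act, hf]]
      exact .refl _
  | none =>
    cases hf : cancel I f w with
    | some u =>
      have h1 := traceEq_of_cancel_eq_some hf
      refine transfer h1 ?_
      refine (one_side (Ne.symm hef) h' u ?_).symm hI
      have h2 := (h1.cancel_eq_none_iff hI e).1 he
      rw [cancel_cons_of_indep _ (Ne.symm hef) h'] at h2
      simpa using h2
    | none =>
      rw [act_of_cancel_eq_none hf, act_of_cancel_eq_none he, act_of_cancel_eq_none,
        act_of_cancel_eq_none]
      · exact .swap _ _ _ h
      · rw [cancel_cons_of_indep _ hef h, hf]; rfl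
      · rw [cancel_cons_of_indep _ (Ne.symm hef) h', he]; rfl

theorem TraceEq.foldr_act (hI : ∀ a b, I a b → I b a) (L : List E) {u v : List E}
    (h : TraceEq I u v) : TraceEq I (L.foldr (FreeBraid.act I) u) (L.foldr (FreeBraid.act I) v) := by
  induction L with
  | nil => exact h
  | cons e L ih => exact ih.act hI e

theorem TraceEq.foldr_act_left (hI : ∀ a b, I a b → I b a) {L L' : List E} (h : TraceEq I L L')
    (u : List E) :
    TraceEq I (L.foldr (FreeBraid.act I) u) (L'.foldr (FreeBraid.act I) u) := by
  induction h with
  | nil => exact .refl _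
  | cons a _ ih => exact ih.act hI a
  | swap a b _ h => exact act_act_comm hI h _
  | trans _ _ ih ih' => exact ih.trans ih'

/-- Deleting a square does not change the normal form, up to commutations. -/
theorem normalize_append_cons_cons (hI : ∀ a b, I a b → I b a) (L L' : List E) (e : E) :
    TraceEq I (normalize I (L ++ [e, e] ++ L')) (normalize I (L ++ [] ++ L')) := by
  simp only [normalize, List.foldr_append, List.foldr_cons, List.foldr_nil]
  exact (act_act_self hI (reduced_normalize hI L') e).foldr_act hI L

theorem normalize_append_traceEq (hI : ∀ a b, I a b → I b a) (L L' : List E) {p q : List E}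
    (h : TraceEq I p q) :
    TraceEq I (normalize I (L ++ p ++ L')) (normalize I (L ++ q ++ L')) := by
  simp only [normalize, List.foldr_append]
  exact (h.foldr_act_left hI _).foldr_act hI L

theorem exists_append_of_cancel_ne_none {e : E} {w : List E} (h : cancel I e w ≠ none) :
    ∃ Y Z, w = Y ++ e :: Z ∧ ∀ f ∈ Y, I f e := by
  induction w with
  | nil => simp [cancel] at h
  | cons x w ih =>
    by_cases hxe : x = e
    · subst hxe
      exact ⟨[], w, rfl, by simp⟩
    by_cases hx : I x e
    · rw [cancel_cons_of_indep _ hxe hx] at h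
      obtain ⟨Y, Z, rfl, hY⟩ := ih (by simpa using h)
      exact ⟨x :: Y, Z, rfl, by simpa [hx] using hY⟩
    · exact absurd (cancel_cons_of_dep _ hxe hx) h

/-- The pattern found here is the algebraic form of a bigon. -/
theorem exists_append_of_not_reduced {w : List E} (h : ¬ Reduced I w) :
    ∃ X e Y Z, w = X ++ e :: (Y ++ e :: Z) ∧ ∀ f ∈ Y, I f e := by
  induction w with
  | nil => exact absurd trivial h
  | cons x w ih =>
    by_cases hc : cancel I x w = none
    · obtain ⟨X, e, Y, Z, rfl, hY⟩ := ih fun hw => h ⟨hc, hw⟩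
      exact ⟨x :: X, e, Y, Z, rfl, hY⟩
    · obtain ⟨Y, Z, rfl, hY⟩ := exists_append_of_cancel_ne_none hc
      exact ⟨[], x, Y, Z, rfl, hY⟩

/-- Commutation is only required for letters of the list; the equality of supports in the conclusion
keeps this hypothesis available along `trans`. -/
theorem TraceEq.prod_map_eq {M : Type*} [Monoid M] (s : E → M)
    {u v : List E} (h : TraceEq I u v)
    (hs : ∀ a ∈ u, ∀ b ∈ u, I a b → s a * s b = s b * s a) :
    (u.map s).prod = (v.map s).prod ∧ ∀ x, x ∈ u ↔ x ∈ v := by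
  induction h with
  | nil => simp
  | cons a _ ih =>
    obtain ⟨h1, h2⟩ := ih fun a ha b hb => hs a (List.mem_cons_of_mem _ ha) b
      (List.mem_cons_of_mem _ hb)
    simp [h1, h2]
  | swap a b u h =>
    constructor
    · simp only [List.map_cons, List.prod_cons, ← mul_assoc]
      rw [hs a (by simp) b (by simp) h]
    · intro x; simp only [List.mem_cons]; tauto
  | trans _ _ ih ih' =>
    obtain ⟨h1, h2⟩ := ih hs
    obtain ⟨h3, h4⟩ := ih' fun a ha b hb => hs a ((h2 a).2 ha) b ((h2 b).2 hb)
    exact ⟨h1.trans h3, fun x => (h2 x).trans (h4 x)⟩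

end Trace

/-! ### The list of crossing pairs and its behaviour under the relations -/

section Words

variable {n : ℕ}

/-- The pair of strands in the positions crossed by a letter with index `i`,
if the strands above are permuted according to `σ`. -/
def edge (σ : Equiv.Perm (Fin n)) (i : Fin (n - 1)) : Finset (Fin n) :=
  {σ (leftPos i), σ (rightPos i)}

/-- The pairs of strands meeting in the classical crossings of a word, where `σ` describes the
order of the strands above the word. -/
def edgesFrom (σ : Equiv.Perm (Fin n)) : Word n → List (Finset (Fin n))
  | [] => []
  | zeta i :: w => edge σ i :: edgesFrom (σ * (zeta i).swap) w
  | tau i :: w => edgesFrom (σ * (tau i).swap) w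

@[simp] theorem strandAt_nil : strandAt ([] : Word n) = 1 := rfl

@[simp] theorem strandAt_cons (g : Letter n) (w : Word n) :
    strandAt (g :: w) = g.swap * strandAt w := by simp [strandAt]

@[simp] theorem strandAt_append (u v : Word n) :
    strandAt (u ++ v) = strandAt u * strandAt v := by simp [strandAt]

theorem leftPos_ne_rightPos (i : Fin (n - 1)) : leftPos i ≠ rightPos i := by
  simp [leftPos, rightPos, Fin.ext_iff]

theorem swap_tau (i : Fin (n - 1)) :
    (tau i).swap = Equiv.swap (leftPos i) (rightPos i) := rfl

theorem swap_zeta (i : Fin (n - 1)) :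
    (zeta i).swap = Equiv.swap (leftPos i) (rightPos i) := rfl

theorem edgesFrom_append (σ : Equiv.Perm (Fin n)) (u v : Word n) :
    edgesFrom σ (u ++ v) = edgesFrom σ u ++ edgesFrom (σ * strandAt u) v := by
  induction u generalizing σ with
  | nil => simp [edgesFrom]
  | cons g u ih => cases g <;> simp [edgesFrom, ih, mul_assoc]

/-- Multiplying on the left renames the strands, without changing which positions meet. -/
theorem edgesFrom_mul (π σ : Equiv.Perm (Fin n)) (w : Word n) :
    edgesFrom (π * σ) w = (edgesFrom σ w).map (Finset.map π.toEmbedding) := by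
  induction w generalizing σ with
  | nil => rfl
  | cons g w ih => cases g <;> simp [edgesFrom, ← ih, mul_assoc, edge]

theorem edge_mul_swap (σ : Equiv.Perm (Fin n)) (i : Fin (n - 1)) :
    edge (σ * Equiv.swap (leftPos i) (rightPos i)) i = edge σ i := by
  simp [edge, Finset.pair_comm]

theorem edge_mul_swap_of_far (σ : Equiv.Perm (Fin n)) {i j : Fin (n - 1)}
    (h : i.val + 2 ≤ j.val ∨ j.val + 2 ≤ i.val) :
    edge (σ * Equiv.swap (leftPos i) (rightPos i)) j = edge σ j := by
  simp only [edge, Equiv.Perm.mul_apply]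
  rw [Equiv.swap_apply_of_ne_of_ne, Equiv.swap_apply_of_ne_of_ne] <;>
    simp only [leftPos, rightPos, ne_eq, Fin.ext_iff] <;> omega

theorem disjoint_edge_of_far (σ : Equiv.Perm (Fin n)) {i j : Fin (n - 1)}
    (h : i.val + 2 ≤ j.val ∨ j.val + 2 ≤ i.val) :
    Disjoint (edge σ i) (edge σ j) := by
  simp only [edge, Finset.disjoint_insert_left, Finset.disjoint_singleton_left,
    Finset.mem_insert, Finset.mem_singleton, EmbeddingLike.apply_eq_iff_eq]
  simp only [leftPos, rightPos, Fin.ext_iff]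
  omega

theorem swap_comm_of_far {i j : Fin (n - 1)}
    (h : i.val + 2 ≤ j.val ∨ j.val + 2 ≤ i.val) :
    Equiv.swap (leftPos i) (rightPos i) * Equiv.swap (leftPos j) (rightPos j) =
      Equiv.swap (leftPos j) (rightPos j) * Equiv.swap (leftPos i) (rightPos i) := by
  have hd := disjoint_edge_of_far 1 h
  simp only [edge, Finset.disjoint_insert_left, Finset.disjoint_singleton_left,
    Finset.mem_insert, Finset.mem_singleton, Equiv.Perm.one_apply, not_or] at hd
  rw [Equiv.mul_swap_eq_swap_mul, Equiv.swap_apply_of_ne_of_ne, Equiv.swap_apply_of_ne_of_ne]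
  · exact Ne.symm hd.1.2
  · exact Ne.symm hd.2.2
  · exact Ne.symm hd.1.1
  · exact Ne.symm hd.2.1

theorem leftPos_eq_rightPos {i j : Fin (n - 1)} (h : j.val = i.val + 1) :
    leftPos j = rightPos i := by
  simp [leftPos, rightPos, h]

theorem swap_braid {i j : Fin (n - 1)} (h : j.val = i.val + 1) :
    Equiv.swap (leftPos i) (rightPos i) * (Equiv.swap (leftPos j) (rightPos j) *
      Equiv.swap (leftPos i) (rightPos i)) =
    Equiv.swap (leftPos j) (rightPos j) * (Equiv.swap (leftPos i) (rightPos i) *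
      Equiv.swap (leftPos j) (rightPos j)) := by
  rw [leftPos_eq_rightPos h]
  have h1 := leftPos_ne_rightPos i
  have h2 := leftPos_ne_rightPos j
  rw [leftPos_eq_rightPos h] at h2
  have h3 : leftPos i ≠ rightPos j := by simp [leftPos, rightPos, Fin.ext_iff]; omega
  have e1 := Equiv.swap_mul_swap_mul_swap h2.symm h3.symm
  rw [Equiv.swap_comm (rightPos i) (leftPos i), Equiv.swap_comm (rightPos j) (rightPos i)] at e1
  rw [← mul_assoc, ← mul_assoc, e1, Equiv.swap_mul_swap_mul_swap h1 h3, Equiv.swap_comm]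

theorem swap_mul_swap_apply {i j : Fin (n - 1)} (h : j.val = i.val + 1) :
    Equiv.swap (leftPos i) (rightPos i) (Equiv.swap (leftPos j) (rightPos j) (leftPos i)) =
      leftPos j ∧
    Equiv.swap (leftPos i) (rightPos i) (Equiv.swap (leftPos j) (rightPos j) (rightPos i)) =
      rightPos j := by
  have h1 := leftPos_ne_rightPos i
  have h2 := leftPos_ne_rightPos j
  have h3 : leftPos i ≠ rightPos j := by simp [leftPos, rightPos, Fin.ext_iff]; omega
  rw [leftPos_eq_rightPos h] at h2 ⊢
  rw [Equiv.swap_apply_of_ne_of_ne h1 h3, Equiv.swap_apply_left, Equiv.swap_apply_left,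
    Equiv.swap_apply_of_ne_of_ne h3.symm h2.symm]
  exact ⟨rfl, rfl⟩

theorem StrongRel.strandAt_eq {p q : Word n} (h : StrongRel p q) : strandAt p = strandAt q := by
  cases h with
  | tau_sq i => simp [Letter.swap]
  | virtualization i => simp [Letter.swap]
  | far_zeta_zeta i j h => simpa [Letter.swap] using swap_comm_of_far h
  | far_zeta_tau i j h => simpa [Letter.swap] using swap_comm_of_far h
  | far_tau_tau i j h => simpa [Letter.swap] using swap_comm_of_far h
  | virtual_three i j h => simpa [Letter.swap] using swap_braid h
  | semivirtual_three i j h => simpa [Letter.swap] using swap_braid h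

theorem DefRel.strandAt_eq {p q : Word n} (h : DefRel p q) : strandAt p = strandAt q := by
  cases h with
  | strong h => exact h.strandAt_eq
  | zeta_sq i => simp [Letter.swap]

/-- Only the far commutation of two `ζ`s alters the list; every other relation has at most one
classical crossing on each side, with the same pair of strands. -/
theorem StrongRel.edgesFrom_traceEq {p q : Word n} (h : StrongRel p q)
    (σ : Equiv.Perm (Fin n)) : TraceEq Disjoint (edgesFrom σ p) (edgesFrom σ q) := by
  cases h with
  | tau_sq i => exact .refl _
  | virtualization i =>
    simp only [edgesFrom, Letter.swap, edge_mul_swap]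
    exact .refl _
  | far_zeta_zeta i j h =>
    simp only [edgesFrom, Letter.swap, edge_mul_swap_of_far σ h, edge_mul_swap_of_far σ h.symm]
    exact .swap _ _ _ (disjoint_edge_of_far σ h)
  | far_zeta_tau i j h =>
    simp only [edgesFrom, Letter.swap, edge_mul_swap_of_far σ h.symm]
    exact .refl _
  | far_tau_tau i j h => exact .refl _
  | virtual_three i j h => exact .refl _
  | semivirtual_three i j h =>
    simp only [edgesFrom, Letter.swap, edge, Equiv.Perm.mul_apply, (swap_mul_swap_apply h).1,
      (swap_mul_swap_apply h).2]
    exact .refl _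

/-! ### Presented monoids and their comparison with `F_n` -/

/-- A single application of a relation inside a word. -/
def Move (R : Word n → Word n → Prop) (β β' : Word n) : Prop :=
  ∃ A B p q : Word n, R p q ∧ β = A ++ p ++ B ∧ β' = A ++ q ++ B

theorem Move.append {R : Word n → Word n → Prop} {u v : Word n} (h : Move R u v)
    (X Y : Word n) : Move R (X ++ u ++ Y) (X ++ v ++ Y) := by
  obtain ⟨A, B, p, q, hpq, rfl, rfl⟩ := h
  exact ⟨X ++ A, B ++ Y, p, q, hpq, by simp, by simp⟩

theorem eqvGen_move_append {R : Word n → Word n → Prop} {u v : Word n}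
    (h : Relation.EqvGen (Move R) u v) (X Y : Word n) :
    Relation.EqvGen (Move R) (X ++ u ++ Y) (X ++ v ++ Y) := by
  induction h with
  | rel _ _ h => exact .rel _ _ (h.append X Y)
  | refl _ => exact .refl _
  | symm _ _ _ ih => exact .symm _ _ ih
  | trans _ _ _ _ _ ih ih' => exact .trans _ _ _ ih ih'

/-- The congruence on words generated by a set of relations. -/
def wordCon (R : Word n → Word n → Prop) : Con (FreeMonoid (Letter n)) where
  r u v := Relation.EqvGen (Move R) u.toList v.toList
  iseqv := ⟨fun _ => .refl _, fun h => .symm _ _ h, fun h h' => .trans _ _ _ h h'⟩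
  mul' {a b c d} h h' := by
    have h1 := eqvGen_move_append h [] c.toList
    have h2 := eqvGen_move_append h' b.toList []
    simp only [List.nil_append, List.append_nil] at h1 h2
    exact .trans _ _ _ h1 h2

/-- The class of a word in the monoid with relations `R`. -/
def wordClass (R : Word n → Word n → Prop) (w : Word n) : (wordCon R).Quotient :=
  (FreeMonoid.ofList w : FreeMonoid (Letter n))

variable {R : Word n → Word n → Prop}

theorem wordClass_eq_iff {u v : Word n} :
    wordClass R u = wordClass R v ↔ Relation.EqvGen (Move R) u v :=
  Con.eq _

theorem wordClass_append (u v : Word n) :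
    wordClass R (u ++ v) = wordClass R u * wordClass R v := rfl

theorem wordClass_nil : wordClass R [] = 1 := rfl

theorem wordClass_cons (g : Letter n) (v : Word n) :
    wordClass R (g :: v) = wordClass R [g] * wordClass R v := rfl

theorem wordClass_eq_of_rel {p q : Word n} (h : R p q) : wordClass R p = wordClass R q :=
  wordClass_eq_iff.2 (.rel _ _ ⟨[], [], p, q, h, by simp, by simp⟩)

/-- The homomorphism from the monoid with relations `R` defined by the images of the letters. -/
def wordLift {N : Type*} [Monoid N] (f : Letter n → N)
    (hf : ∀ p q, R p q → (p.map f).prod = (q.map f).prod) : (wordCon R).Quotient →* N :=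
  (wordCon R).lift (FreeMonoid.lift f) <| by
    intro u v h
    rw [Con.ker_rel, FreeMonoid.lift_apply, FreeMonoid.lift_apply]
    have h : Relation.EqvGen (Move R) u.toList v.toList := h
    generalize u.toList = u, v.toList = v at h
    induction h with
    | rel _ _ h =>
      obtain ⟨A, B, p, q, hpq, rfl, rfl⟩ := h
      simp [hf p q hpq]
    | refl _ => rfl
    | symm _ _ _ ih => exact ih.symm
    | trans _ _ _ _ _ ih ih' => exact ih.trans ih'

theorem wordLift_wordClass {N : Type*} [Monoid N] (f : Letter n → N)
    (hf : ∀ p q, R p q → (p.map f).prod = (q.map f).prod) (w : Word n) :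
    wordLift f hf (wordClass R w) = (w.map f).prod :=
  FreeMonoid.lift_ofList f w

theorem toF_eq_of_defRel {p q : Word n} (h : DefRel p q) : Word.toF p = Word.toF q := by
  have h1 : (PresentedGroup.mk (relators n))
      ((p.map FreeGroup.of).prod * ((q.map FreeGroup.of).prod)⁻¹) = 1 :=
    PresentedGroup.one_of_mem ⟨p, q, h, rfl⟩
  rw [map_mul, map_inv, mul_inv_eq_one, map_list_prod, map_list_prod, List.map_map,
    List.map_map] at h1
  exact h1

theorem letter_mul_self (g : Letter n) : wordClass DefRel [g] * wordClass DefRel [g] = 1 := by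
  rw [← wordClass_append]
  cases g with
  | zeta i => exact wordClass_eq_of_rel (.zeta_sq i)
  | tau i => exact wordClass_eq_of_rel (.strong (.tau_sq i))

/-- Letters are units in the monoid defined by the relations of `F_n`. -/
def letterUnit (g : Letter n) : (wordCon (DefRel (n := n))).Quotientˣ :=
  ⟨wordClass DefRel [g], wordClass DefRel [g], letter_mul_self g, letter_mul_self g⟩

theorem val_prod_letterUnit (w : Word n) :
    (((w.map letterUnit).prod : (wordCon (DefRel (n := n))).Quotientˣ) :
      (wordCon (DefRel (n := n))).Quotient) = wordClass DefRel w := by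
  induction w with
  | nil => rfl
  | cons g w ih =>
    rw [List.map_cons, List.prod_cons, Units.val_mul, ih]
    rfl

/-- Every letter is its own inverse, so the group presentation maps to the units of the monoid with
the same relations. Equality in `F_n` thus becomes a chain of moves on words without inverses. -/
theorem wordClass_eq_of_toF_eq {u v : Word n} (h : Word.toF u = Word.toF v) :
    wordClass DefRel u = wordClass DefRel v := by
  have hrel : ∀ r ∈ relators n, FreeGroup.lift letterUnit r = 1 := by
    rintro _ ⟨p, q, hpq, rfl⟩
    rw [map_mul, map_inv, mul_inv_eq_one, map_list_prod, map_list_prod, List.map_map,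
      List.map_map]
    simp only [Function.comp_def, FreeGroup.lift_apply_of]
    ext
    rw [val_prod_letterUnit, val_prod_letterUnit]
    exact wordClass_eq_of_rel hpq
  have key : ∀ w : Word n, PresentedGroup.toGroup hrel (Word.toF w) =
      (w.map letterUnit).prod := by
    intro w
    rw [Word.toF, map_list_prod, List.map_map]
    simp only [Function.comp_def, PresentedGroup.toGroup.of]
  rw [← val_prod_letterUnit, ← val_prod_letterUnit, ← key, ← key, h]

theorem strandAt_eq_of_toF_eq {u v : Word n} (h : Word.toF u = Word.toF v) :
    strandAt u = strandAt v := by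
  have h' := congrArg (wordLift Letter.swap fun _ _ h => h.strandAt_eq) (wordClass_eq_of_toF_eq h)
  exact (wordLift_wordClass ..).symm.trans (h'.trans (wordLift_wordClass ..))

theorem normalize_edgesFrom_traceEq_of_toF_eq {u v : Word n} (h : Word.toF u = Word.toF v) :
    TraceEq Disjoint (normalize Disjoint (edgesFrom 1 u))
      (normalize Disjoint (edgesFrom 1 v)) := by
  have hI : ∀ a b : Finset (Fin n), Disjoint a b → Disjoint b a := fun _ _ h => h.symm
  replace h := wordClass_eq_iff.1 (wordClass_eq_of_toF_eq h)
  induction h with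
  | rel _ _ h =>
    obtain ⟨A, B, p, q, hpq, rfl, rfl⟩ := h
    simp only [edgesFrom_append, strandAt_append, hpq.strandAt_eq]
    cases hpq with
    | strong h => exact normalize_append_traceEq hI _ _ (h.edgesFrom_traceEq _)
    | zeta_sq i =>
      simp only [edgesFrom, Letter.swap, edge_mul_swap]
      exact normalize_append_cons_cons hI _ _ _
  | refl _ => exact .refl _
  | symm _ _ _ ih => exact ih.symm hI
  | trans _ _ _ _ _ ih ih' => exact ih.trans ih'

end Words

/-! ### Coset representatives from the Coxeter relations -/

section Ascending

variable {K : Type*} [Monoid K] {t : ℕ → K} {n : ℕ}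

/-- The product `t m * t (m + 1) * ⋯ * t (m + k - 1)`. -/
def ascProd (t : ℕ → K) (m : ℕ) : ℕ → K
  | 0 => 1
  | k + 1 => ascProd t m k * t (m + k)

/-- The relations of the symmetric group for a sequence in a monoid, up to a given index. -/
structure CoxeterRelations (t : ℕ → K) (N : ℕ) : Prop where
  sq : ∀ i < N, t i * t i = 1
  far : ∀ i j, i + 2 ≤ j → j < N → t i * t j = t j * t i
  braid : ∀ i, i + 1 < N → t i * t (i + 1) * t i = t (i + 1) * t i * t (i + 1)

variable {N : ℕ}

theorem ascProd_mul_of_lt (ht : CoxeterRelations t N) {m k i : ℕ} (hi : m + k < i) (hN : i < N) :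
    ascProd t m k * t i = t i * ascProd t m k := by
  induction k with
  | zero => simp [ascProd]
  | succ k ih =>
    rw [ascProd, mul_assoc, ht.far (m + k) i (by omega) hN, ← mul_assoc, ih (by omega), mul_assoc]

theorem ascProd_mul_of_le (ht : CoxeterRelations t N) {m k i : ℕ} (hm : m ≤ i) (hi : i + 1 < m + k) (hN : m + k ≤ N) :
    ascProd t m k * t i = t (i + 1) * ascProd t m k := by
  induction k with
  | zero => omega
  | succ k ih =>
    -- When `t i` is the penultimate factor the braid relation applies; otherwise `t i` first passes
    -- the last factor.
    by_cases h : i + 1 = m + k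
    · obtain ⟨l, rfl⟩ : ∃ l, k = l + 1 := ⟨k - 1, by omega⟩
      obtain rfl : i = m + l := by omega
      rw [ascProd, ascProd, show m + (l + 1) = m + l + 1 by omega, mul_assoc, mul_assoc,
        ← mul_assoc (t (m + l)), ht.braid _ (by omega), ← mul_assoc, ← mul_assoc,
        ascProd_mul_of_lt ht (by omega) (by omega)]
      simp only [mul_assoc]
    · rw [ascProd, mul_assoc, ← ht.far i (m + k) (by omega) (by omega), ← mul_assoc,
        ih (by omega) (by omega), mul_assoc]

/-- The ascending products starting at `m` represent the cosets of the submonoid generated from `m +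
1` on: a further generator lengthens the product, shortens it, or passes through it into `v`. -/
theorem exists_mul_ascProd (ht : CoxeterRelations t N) {m : ℕ} (hm : m ≤ N) {u : K}
    (hu : u ∈ Submonoid.closure (t '' Set.Ico m N)) :
    ∃ v ∈ Submonoid.closure (t '' Set.Ico (m + 1) N), ∃ k, m + k ≤ N ∧ u = v * ascProd t m k := by
  induction hu using Submonoid.closure_induction_right with
  | one => exact ⟨1, one_mem _, 0, hm, by simp [ascProd]⟩
  | mul_right x _ y hy ih =>
    obtain ⟨i, ⟨hmi, hiN⟩, rfl⟩ := hy
    obtain ⟨v, hv, k, hk, rfl⟩ := ih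
    have gen : ∀ j, m + 1 ≤ j → j < N → v * t j ∈ Submonoid.closure (t '' Set.Ico (m + 1) N) :=
      fun j h h' => mul_mem hv (Submonoid.subset_closure ⟨j, ⟨h, h'⟩, rfl⟩)
    rcases lt_trichotomy i (m + k) with h | rfl | h
    · by_cases h' : i + 1 = m + k
      · obtain ⟨l, rfl⟩ : ∃ l, k = l + 1 := ⟨k - 1, by omega⟩
        obtain rfl : i = m + l := by omega
        refine ⟨v, hv, l, by omega, ?_⟩
        rw [ascProd, mul_assoc, mul_assoc, ht.sq _ hiN, mul_one]
      · refine ⟨_, gen (i + 1) (by omega) (by omega), k, hk, ?_⟩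
        rw [mul_assoc, ascProd_mul_of_le ht hmi (by omega) hk, mul_assoc]
    · exact ⟨v, hv, k + 1, by omega, by rw [ascProd, mul_assoc]⟩
    · refine ⟨_, gen i (by omega) hiN, k, hk, ?_⟩
      rw [mul_assoc, ascProd_mul_of_lt ht h hiN, mul_assoc]

/-- The image of the product reveals its length `k`, so distinct coset representatives have distinct
permutations. -/
theorem map_ascProd_apply {P : K →* Equiv.Perm (Fin n)}
    (hP : ∀ i : Fin (n - 1), P (t i) = Equiv.swap (leftPos i) (rightPos i)) {m k : ℕ}
    (h : m + k < n) : P (ascProd t m k) ⟨m + k, h⟩ = ⟨m, by omega⟩ := by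
  induction k with
  | zero => simp [ascProd]
  | succ k ih =>
    rw [ascProd, map_mul, hP ⟨m + k, by omega⟩, Equiv.Perm.mul_apply,
      show (⟨m + (k + 1), h⟩ : Fin n) = rightPos ⟨m + k, by omega⟩ from rfl,
      Equiv.swap_apply_right]
    exact ih (by omega)

theorem map_apply_of_mem_closure {P : K →* Equiv.Perm (Fin n)}
    (hP : ∀ i : Fin (n - 1), P (t i) = Equiv.swap (leftPos i) (rightPos i)) {m : ℕ} {u : K}
    (hu : u ∈ Submonoid.closure (t '' Set.Ico m (n - 1))) {p : Fin n} (hp : p.val < m) :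
    P u p = p := by
  induction hu using Submonoid.closure_induction with
  | one => simp
  | mul x y _ _ hx hy => rw [map_mul, Equiv.Perm.mul_apply, hy, hx]
  | mem x hx =>
    obtain ⟨i, ⟨hi, hi'⟩, rfl⟩ := hx
    rw [hP ⟨i, hi'⟩, Equiv.swap_apply_of_ne_of_ne] <;>
      simp only [leftPos, rightPos, ne_eq, Fin.ext_iff] <;> omega

end Ascending

/-! ### The Coxeter presentation of the symmetric group -/

section Symmetric

variable {K : Type*} [Monoid K] {t : ℕ → K} {n : ℕ} {P : K →* Equiv.Perm (Fin n)}

/-- Descend through the parabolic submonoids: the ascending factor carries `m + k` to `m`, so fixing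
`m` forces `k = 0`. -/
theorem mem_closure_of_forall_apply_eq (ht : CoxeterRelations t (n - 1))
    (hP : ∀ i : Fin (n - 1), P (t i) = Equiv.swap (leftPos i) (rightPos i)) {u : K}
    (hu : u ∈ Submonoid.closure (t '' Set.Ico 0 (n - 1))) {m : ℕ} (hm : m ≤ n - 1)
    (h : ∀ p : Fin n, p.val < m → P u p = p) :
    u ∈ Submonoid.closure (t '' Set.Ico m (n - 1)) := by
  induction m with
  | zero => exact hu
  | succ m ih =>
    obtain ⟨v, hv, k, hk, rfl⟩ := exists_mul_ascProd ht (by omega)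
      (ih (by omega) fun p hp => h p (by omega))
    have h1 := map_ascProd_apply hP (m := m) (k := k) (by omega)
    have h2 := map_apply_of_mem_closure hP hv (p := ⟨m, by omega⟩) (Nat.lt_succ_self m)
    have h3 := h ⟨m, by omega⟩ (Nat.lt_succ_self m)
    have h4 : P (v * ascProd t m k) ⟨m + k, by omega⟩ = ⟨m, by omega⟩ := by
      rw [map_mul, Equiv.Perm.mul_apply, h1, h2]
    have h5 := (P (v * ascProd t m k)).injective (h3.trans h4.symm)
    obtain rfl : k = 0 := by simpa using h5
    simpa [ascProd] using hv

theorem exists_inverse_of_mem_closure (ht : CoxeterRelations t (n - 1)) {u : K}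
    (hu : u ∈ Submonoid.closure (t '' Set.Ico 0 (n - 1))) :
    ∃ v ∈ Submonoid.closure (t '' Set.Ico 0 (n - 1)), u * v = 1 ∧ v * u = 1 := by
  induction hu using Submonoid.closure_induction with
  | one => exact ⟨1, one_mem _, by simp, by simp⟩
  | mul x y _ _ hx hy =>
    obtain ⟨a, ha, h1, h2⟩ := hx
    obtain ⟨b, hb, h3, h4⟩ := hy
    refine ⟨b * a, mul_mem hb ha, ?_, ?_⟩
    · rw [mul_assoc, ← mul_assoc y, h3, one_mul, h1]
    · rw [mul_assoc, ← mul_assoc a, h2, one_mul, h4]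
  | mem x hx =>
    obtain ⟨i, hi, rfl⟩ := hx
    exact ⟨t i, Submonoid.subset_closure ⟨i, hi, rfl⟩, ht.sq i hi.2, ht.sq i hi.2⟩

/-- The quotient of `u` by `v` fixes every point, hence lies in the submonoid generated from `n - 1`
on, which has no generators. -/
theorem eq_of_map_eq (ht : CoxeterRelations t (n - 1))
    (hP : ∀ i : Fin (n - 1), P (t i) = Equiv.swap (leftPos i) (rightPos i)) {u v : K}
    (hu : u ∈ Submonoid.closure (t '' Set.Ico 0 (n - 1)))
    (hv : v ∈ Submonoid.closure (t '' Set.Ico 0 (n - 1))) (h : P u = P v) : u = v := by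
  obtain ⟨w, hw, h1, h2⟩ := exists_inverse_of_mem_closure ht hv
  have h3 := mem_closure_of_forall_apply_eq ht hP (mul_mem hw hu) le_rfl fun p _ => by
    rw [map_mul, h, ← map_mul, h2, map_one, Equiv.Perm.one_apply]
  rw [Set.Ico_self, Set.image_empty, Submonoid.closure_empty, Submonoid.mem_bot] at h3
  calc u = v * (w * u) := by rw [← mul_assoc, h1, one_mul]
    _ = v := by rw [h3, mul_one]

theorem closure_swap_eq_top (n : ℕ) : Submonoid.closure
    (Set.range fun i : Fin (n - 1) => Equiv.swap (leftPos i) (rightPos i)) = ⊤ := by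
  cases n with
  | zero => exact Subsingleton.elim _ _
  | succ n => exact Equiv.Perm.mclosure_swap_castSucc_succ n

theorem exists_mem_closure_map_eq
    (hP : ∀ i : Fin (n - 1), P (t i) = Equiv.swap (leftPos i) (rightPos i))
    (σ : Equiv.Perm (Fin n)) :
    ∃ u ∈ Submonoid.closure (t '' Set.Ico 0 (n - 1)), P u = σ := by
  have h : σ ∈ Submonoid.closure
    (Set.range fun i : Fin (n - 1) => Equiv.swap (leftPos i) (rightPos i)) := by
    rw [closure_swap_eq_top]; trivial
  induction h using Submonoid.closure_induction with
  | one => exact ⟨1, one_mem _, map_one _⟩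
  | mul x y _ _ hx hy =>
    obtain ⟨a, ha, rfl⟩ := hx
    obtain ⟨b, hb, rfl⟩ := hy
    exact ⟨a * b, mul_mem ha hb, map_mul _ _ _⟩
  | mem x hx =>
    obtain ⟨i, rfl⟩ := hx
    exact ⟨t i, Submonoid.subset_closure ⟨i, ⟨Nat.zero_le _, i.2⟩, rfl⟩, hP i⟩

/-- A section of `P`, by the Coxeter presentation of the symmetric group. -/
theorem exists_section (ht : CoxeterRelations t (n - 1))
    (hP : ∀ i : Fin (n - 1), P (t i) = Equiv.swap (leftPos i) (rightPos i)) :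
    ∃ ρ : Equiv.Perm (Fin n) →* K,
      (∀ σ, ρ σ ∈ Submonoid.closure (t '' Set.Ico 0 (n - 1))) ∧ ∀ σ, P (ρ σ) = σ := by
  choose f hf hPf using exists_mem_closure_map_eq (P := P) hP
  refine ⟨⟨⟨f, ?_⟩, ?_⟩, hf, hPf⟩
  · exact eq_of_map_eq ht hP (hf _) (one_mem _) (by rw [hPf, map_one])
  · intro σ τ
    exact eq_of_map_eq ht hP (hf _) (mul_mem (hf _) (hf _)) (by simp only [map_mul, hPf])

end Symmetric

/-! ### Factorization of the strong monoid into crossings and permutations -/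

noncomputable section StrongMonoid

variable {n : ℕ}

/-- The monoid of braid-words up to strong equivalence. -/
abbrev StrongMonoid (n : ℕ) := (wordCon (StrongRel (n := n))).Quotient

/-- The class of the letter `τ_i` in the strong monoid. -/
def tauClass (i : Fin (n - 1)) : StrongMonoid n := wordClass StrongRel [tau i]

/-- The class of the letter `ζ_i` in the strong monoid. -/
def zetaClass (i : Fin (n - 1)) : StrongMonoid n := wordClass StrongRel [zeta i]

/-- The classes of the letters `τ_i`, continued by `1` to a sequence. -/
def tauSeq (n : ℕ) (i : ℕ) : StrongMonoid n := if h : i < n - 1 then tauClass ⟨i, h⟩ else 1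

theorem tauSeq_of_lt {i : ℕ} (h : i < n - 1) : tauSeq n i = tauClass ⟨i, h⟩ := dif_pos h

theorem tauSeq_val (i : Fin (n - 1)) : tauSeq n i = tauClass i := dif_pos i.2

theorem tauClass_mul_self (i : Fin (n - 1)) : tauClass i * tauClass i = 1 :=
  wordClass_eq_of_rel (.tau_sq i)

theorem tauClass_mul_zetaClass (i : Fin (n - 1)) :
    tauClass i * zetaClass i = zetaClass i * tauClass i :=
  wordClass_eq_of_rel (.virtualization i)

theorem zetaClass_mul_tauClass_of_far {i j : Fin (n - 1)}
    (h : i.val + 2 ≤ j.val ∨ j.val + 2 ≤ i.val) :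
    zetaClass i * tauClass j = tauClass j * zetaClass i :=
  wordClass_eq_of_rel (.far_zeta_tau i j h)

theorem zetaClass_mul_zetaClass_of_far {i j : Fin (n - 1)}
    (h : i.val + 2 ≤ j.val ∨ j.val + 2 ≤ i.val) :
    zetaClass i * zetaClass j = zetaClass j * zetaClass i :=
  wordClass_eq_of_rel (.far_zeta_zeta i j h)

theorem tauClass_mul_tauClass_of_far {i j : Fin (n - 1)}
    (h : i.val + 2 ≤ j.val ∨ j.val + 2 ≤ i.val) :
    tauClass i * tauClass j = tauClass j * tauClass i :=
  wordClass_eq_of_rel (.far_tau_tau i j h)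

theorem tauClass_mul_tauClass_mul_zetaClass {i j : Fin (n - 1)} (h : j.val = i.val + 1) :
    tauClass i * tauClass j * zetaClass i = zetaClass j * tauClass i * tauClass j :=
  wordClass_eq_of_rel (.semivirtual_three i j h)

theorem coxeterRelations_tauSeq (n : ℕ) : CoxeterRelations (tauSeq n) (n - 1) where
  sq i hi := by rw [tauSeq_of_lt hi, tauClass_mul_self]
  far i j h hj := by
    rw [tauSeq_of_lt hj, tauSeq_of_lt (show i < n - 1 by omega)]
    exact tauClass_mul_tauClass_of_far (Or.inl h)
  braid i hi := by
    rw [tauSeq_of_lt hi, tauSeq_of_lt (show i < n - 1 by omega)]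
    exact wordClass_eq_of_rel (.virtual_three ⟨i, by omega⟩ ⟨i + 1, hi⟩ rfl)

/-- The permutation of an element of the strong monoid. -/
def strongPerm (n : ℕ) : StrongMonoid n →* Equiv.Perm (Fin n) :=
  wordLift Letter.swap fun _ _ h => h.strandAt_eq

theorem strongPerm_wordClass (w : Word n) : strongPerm n (wordClass StrongRel w) = strandAt w :=
  wordLift_wordClass ..

theorem strongPerm_tauSeq (i : Fin (n - 1)) :
    strongPerm n (tauSeq n i) = Equiv.swap (leftPos i) (rightPos i) := by
  rw [tauSeq_val, tauClass, strongPerm_wordClass]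
  simp [Letter.swap]

/-- The embedding of the symmetric group into the strong monoid. -/
def ofPerm (n : ℕ) : Equiv.Perm (Fin n) →* StrongMonoid n :=
  (exists_section (coxeterRelations_tauSeq n) strongPerm_tauSeq).choose

theorem ofPerm_mem_closure (σ : Equiv.Perm (Fin n)) :
    ofPerm n σ ∈ Submonoid.closure (tauSeq n '' Set.Ico 0 (n - 1)) :=
  (exists_section (coxeterRelations_tauSeq n) strongPerm_tauSeq).choose_spec.1 σ

theorem strongPerm_ofPerm (σ : Equiv.Perm (Fin n)) : strongPerm n (ofPerm n σ) = σ :=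
  (exists_section (coxeterRelations_tauSeq n) strongPerm_tauSeq).choose_spec.2 σ

theorem ofPerm_swap (i : Fin (n - 1)) :
    ofPerm n (Equiv.swap (leftPos i) (rightPos i)) = tauClass i := by
  rw [← tauSeq_val]
  refine eq_of_map_eq (coxeterRelations_tauSeq n) strongPerm_tauSeq (ofPerm_mem_closure _)
    (Submonoid.subset_closure ⟨i, ⟨Nat.zero_le _, i.2⟩, rfl⟩) ?_
  rw [strongPerm_ofPerm, strongPerm_tauSeq]

theorem ofPerm_mul_ofPerm_inv (σ : Equiv.Perm (Fin n)) : ofPerm n σ * ofPerm n σ⁻¹ = 1 := by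
  rw [← map_mul, mul_inv_cancel, map_one]

theorem ofPerm_inv_mul_ofPerm (σ : Equiv.Perm (Fin n)) : ofPerm n σ⁻¹ * ofPerm n σ = 1 := by
  rw [← map_mul, inv_mul_cancel, map_one]

/-- Conjugation by a permutation in the strong monoid. -/
def permConj (σ : Equiv.Perm (Fin n)) : StrongMonoid n →* StrongMonoid n where
  toFun x := ofPerm n σ * x * ofPerm n σ⁻¹
  map_one' := by rw [mul_one, ofPerm_mul_ofPerm_inv]
  map_mul' x y := by
    rw [mul_assoc (ofPerm n σ * x), ← mul_assoc (ofPerm n σ⁻¹), ← mul_assoc (ofPerm n σ⁻¹),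
      ofPerm_inv_mul_ofPerm, one_mul]
    simp only [mul_assoc]

theorem permConj_apply (σ : Equiv.Perm (Fin n)) (x : StrongMonoid n) :
    permConj σ x = ofPerm n σ * x * ofPerm n σ⁻¹ := rfl

theorem permConj_mul (σ τ : Equiv.Perm (Fin n)) (x : StrongMonoid n) :
    permConj (σ * τ) x = permConj σ (permConj τ x) := by
  simp only [permConj_apply, mul_inv_rev, map_mul (ofPerm n), mul_assoc]

theorem permConj_one (x : StrongMonoid n) : permConj 1 x = x := by
  simp [permConj_apply]

theorem permConj_eq_self_of_commute {σ : Equiv.Perm (Fin n)} {x : StrongMonoid n}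
    (h : ofPerm n σ * x = x * ofPerm n σ) : permConj σ x = x := by
  rw [permConj_apply, h, mul_assoc, ofPerm_mul_ofPerm_inv, mul_one]

theorem permConj_tauClass (σ : Equiv.Perm (Fin n)) (i : Fin (n - 1)) :
    permConj σ (tauClass i) = ofPerm n (Equiv.swap (σ (leftPos i)) (σ (rightPos i))) := by
  rw [permConj_apply, ← ofPerm_swap, ← map_mul, ← map_mul, Equiv.mul_swap_eq_swap_mul,
    mul_assoc, mul_inv_cancel, mul_one]

theorem permConj_swap_mul_swap_zetaClass {i j : Fin (n - 1)} (h : j.val = i.val + 1) :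
    permConj (Equiv.swap (leftPos i) (rightPos i) * Equiv.swap (leftPos j) (rightPos j))
      (zetaClass i) = zetaClass j := by
  rw [permConj_apply, mul_inv_rev, Equiv.swap_inv, Equiv.swap_inv, map_mul, map_mul,
    ofPerm_swap, ofPerm_swap, tauClass_mul_tauClass_mul_zetaClass h, mul_assoc, mul_assoc,
    ← mul_assoc (tauClass j), tauClass_mul_self, one_mul, tauClass_mul_self, mul_one]

/-- The semivirtual relation says that conjugation by `τ_i τ_{i+1}` carries `ζ_i` to `ζ_{i+1}`;
iterating it reduces everything to the first crossing. -/
theorem exists_permConj_zetaClass_zero (i : Fin (n - 1)) :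
    ∃ π : Equiv.Perm (Fin n), π (leftPos ⟨0, i.pos⟩) = leftPos i ∧
      π (rightPos ⟨0, i.pos⟩) = rightPos i ∧ permConj π (zetaClass ⟨0, i.pos⟩) = zetaClass i := by
  obtain ⟨i, hi⟩ := i
  induction i with
  | zero => exact ⟨1, rfl, rfl, permConj_one _⟩
  | succ i ih =>
    obtain ⟨π, h1, h2, h3⟩ := ih (by omega)
    have hij : (⟨i + 1, hi⟩ : Fin (n - 1)).val = (⟨i, by omega⟩ : Fin (n - 1)).val + 1 := rfl
    refine ⟨Equiv.swap (leftPos ⟨i, by omega⟩) (rightPos ⟨i, by omega⟩) *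
      Equiv.swap (leftPos ⟨i + 1, hi⟩) (rightPos ⟨i + 1, hi⟩) * π, ?_, ?_, ?_⟩
    · rw [Equiv.Perm.mul_apply, h1]; exact (swap_mul_swap_apply hij).1
    · rw [Equiv.Perm.mul_apply, h2]; exact (swap_mul_swap_apply hij).2
    · rw [permConj_mul, h3, permConj_swap_mul_swap_zetaClass hij]

/-- A permutation fixing the first two positions is a product of far `τ_i`, all of which commute
with the first `ζ`. -/
theorem permConj_zetaClass_zero_of_fixed (h0 : 0 < n - 1) {σ : Equiv.Perm (Fin n)}
    (h1 : σ (leftPos ⟨0, h0⟩) = leftPos ⟨0, h0⟩) (h2 : σ (rightPos ⟨0, h0⟩) = rightPos ⟨0, h0⟩) :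
    permConj σ (zetaClass ⟨0, h0⟩) = zetaClass ⟨0, h0⟩ := by
  apply permConj_eq_self_of_commute
  have hfix : ∀ p : Fin n, p.val < 2 → strongPerm n (ofPerm n σ) p = p := by
    intro p hp
    rw [strongPerm_ofPerm]
    obtain h | h : p = leftPos ⟨0, h0⟩ ∨ p = rightPos ⟨0, h0⟩ := by
      simp only [leftPos, rightPos, Fin.ext_iff]; omega
    · rw [h, h1]
    · rw [h, h2]
  -- With only two strands the parabolic argument is out of range, but there `σ` is the identity.
  by_cases hn : 2 ≤ n - 1
  · have hmem := mem_closure_of_forall_apply_eq (coxeterRelations_tauSeq n) strongPerm_tauSeq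
      (ofPerm_mem_closure σ) hn hfix
    generalize ofPerm n σ = u at hmem
    clear hfix
    induction hmem using Submonoid.closure_induction with
    | one => simp
    | mul x y _ _ hx hy => rw [mul_assoc, hy, ← mul_assoc, hx, mul_assoc]
    | mem x hx =>
      obtain ⟨i, ⟨hi, hi'⟩, rfl⟩ := hx
      rw [tauSeq_of_lt hi']
      exact (zetaClass_mul_tauClass_of_far (Or.inl (by simpa using hi))).symm
  · obtain rfl : σ = 1 := by
      ext p
      have := hfix p (by omega)
      rw [strongPerm_ofPerm] at this
      rw [this]; rfl
    simp

theorem pair_eq_iff {α : Type*} [DecidableEq α] {a b c d : α} :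
    ({a, b} : Finset α) = {c, d} ↔ a = c ∧ b = d ∨ a = d ∧ b = c := by
  rw [← Finset.coe_inj]
  push_cast
  exact Set.pair_eq_pair_iff

theorem permConj_zetaClass_zero_of_edge_eq (h0 : 0 < n - 1) {σ : Equiv.Perm (Fin n)}
    (h : edge σ ⟨0, h0⟩ = edge 1 ⟨0, h0⟩) :
    permConj σ (zetaClass ⟨0, h0⟩) = zetaClass ⟨0, h0⟩ := by
  rcases pair_eq_iff.1 h with ⟨h1, h2⟩ | ⟨h1, h2⟩
  · exact permConj_zetaClass_zero_of_fixed h0 h1 h2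
  -- If `σ` exchanges the two positions, correct it by the transposition, which commutes with `ζ` by
  -- virtualization.
  · have h3 := permConj_zetaClass_zero_of_fixed h0
      (σ := σ * Equiv.swap (leftPos ⟨0, h0⟩) (rightPos ⟨0, h0⟩)) (by simpa using h2)
      (by simpa using h1)
    rw [permConj_mul, permConj_eq_self_of_commute (σ := Equiv.swap _ _)] at h3
    · exact h3
    · rw [ofPerm_swap, tauClass_mul_zetaClass]

theorem edge_mul (σ τ : Equiv.Perm (Fin n)) (i : Fin (n - 1)) :
    edge (σ * τ) i = (edge τ i).map σ.toEmbedding := by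
  simp [edge]

theorem permConj_zetaClass_eq {σ σ' : Equiv.Perm (Fin n)} {i j : Fin (n - 1)}
    (h : edge σ i = edge σ' j) : permConj σ (zetaClass i) = permConj σ' (zetaClass j) := by
  obtain ⟨π, h1, h2, h3⟩ := exists_permConj_zetaClass_zero i
  obtain ⟨π', h1', h2', h3'⟩ := exists_permConj_zetaClass_zero j
  have hedge : edge (σ * π) ⟨0, i.pos⟩ = edge (σ' * π') ⟨0, i.pos⟩ := by
    simpa only [edge, Equiv.Perm.mul_apply, h1, h2, h1', h2'] using h
  have hγ : permConj ((σ' * π')⁻¹ * (σ * π)) (zetaClass ⟨0, i.pos⟩) = zetaClass ⟨0, i.pos⟩ := by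
    apply permConj_zetaClass_zero_of_edge_eq
    rw [edge_mul, hedge, ← edge_mul, inv_mul_cancel]
  rw [← h3, ← h3', ← permConj_mul, ← permConj_mul]
  conv_rhs => rw [← hγ]
  rw [← permConj_mul, mul_inv_cancel_left]

/-- The element of the strong monoid in which the strands in the positions of the letter with
index `i` meet in a classical crossing, and which has the trivial permutation. -/
def pureCrossing (i : Fin (n - 1)) : StrongMonoid n := zetaClass i * tauClass i

theorem permConj_pureCrossing_eq {σ σ' : Equiv.Perm (Fin n)} {i j : Fin (n - 1)}
    (h : edge σ i = edge σ' j) : permConj σ (pureCrossing i) = permConj σ' (pureCrossing j) := by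
  rw [pureCrossing, pureCrossing, map_mul, map_mul, permConj_zetaClass_eq h, permConj_tauClass,
    permConj_tauClass]
  rcases pair_eq_iff.1 h with ⟨h1, h2⟩ | ⟨h1, h2⟩
  · rw [h1, h2]
  · rw [h1, h2, Equiv.swap_comm]

open Classical in
/-- The pure element of the strong monoid in which the two strands of `e` cross. -/
def crossingOf (e : Finset (Fin n)) : StrongMonoid n :=
  -- The value `1` is never used for pairs arising from words: these are always edges.
  if h : ∃ x : Equiv.Perm (Fin n) × Fin (n - 1), edge x.1 x.2 = e then
    permConj h.choose.1 (pureCrossing h.choose.2) else 1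

theorem crossingOf_edge (σ : Equiv.Perm (Fin n)) (i : Fin (n - 1)) :
    crossingOf (edge σ i) = permConj σ (pureCrossing i) := by
  have h : ∃ x : Equiv.Perm (Fin n) × Fin (n - 1), edge x.1 x.2 = edge σ i := ⟨(σ, i), rfl⟩
  rw [crossingOf, dif_pos h]
  exact permConj_pureCrossing_eq h.choose_spec

theorem pureCrossing_mul_of_far {i j : Fin (n - 1)} (h : i.val + 2 ≤ j.val) :
    pureCrossing i * pureCrossing j = pureCrossing j * pureCrossing i := by
  have h1 : Commute (zetaClass i) (zetaClass j) := zetaClass_mul_zetaClass_of_far (Or.inl h)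
  have h2 : Commute (zetaClass i) (tauClass j) := zetaClass_mul_tauClass_of_far (Or.inl h)
  have h3 : Commute (tauClass i) (zetaClass j) :=
    (zetaClass_mul_tauClass_of_far (Or.inr h)).symm
  have h4 : Commute (tauClass i) (tauClass j) := tauClass_mul_tauClass_of_far (Or.inl h)
  exact (h1.mul_right h2).mul_left (h3.mul_right h4)

/-- The symmetric group is transitive on quadruples of distinct strands, so two disjoint pairs can
be moved simultaneously to positions `0, 1` and `2, 3`, where far commutativity applies. -/
theorem crossingOf_mul_comm {σ σ' : Equiv.Perm (Fin n)} {i j : Fin (n - 1)}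
    (h : Disjoint (edge σ i) (edge σ' j)) :
    crossingOf (edge σ i) * crossingOf (edge σ' j) =
      crossingOf (edge σ' j) * crossingOf (edge σ i) := by
  have hcard := Finset.card_union_of_disjoint h
  have hi : (edge σ i).card = 2 :=
    Finset.card_pair fun h => leftPos_ne_rightPos i (σ.injective h)
  have hj : (edge σ' j).card = 2 :=
    Finset.card_pair fun h => leftPos_ne_rightPos j (σ'.injective h)
  have hn : 4 ≤ n := by
    have h1 := Finset.card_le_univ (edge σ i ∪ edge σ' j)
    rw [hcard, hi, hj, Fintype.card_fin] at h1
    exact h1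
  have hi' : σ (leftPos i) ≠ σ (rightPos i) := fun h => leftPos_ne_rightPos i (σ.injective h)
  have hj' : σ' (leftPos j) ≠ σ' (rightPos j) := fun h => leftPos_ne_rightPos j (σ'.injective h)
  simp only [edge, Finset.disjoint_insert_left, Finset.disjoint_singleton_left,
    Finset.mem_insert, Finset.mem_singleton, not_or] at h
  obtain ⟨⟨hac, had⟩, hbc, hbd⟩ := h
  let y : Fin 4 ↪ Fin n := ⟨![σ (leftPos i), σ (rightPos i), σ' (leftPos j), σ' (rightPos j)], by
    intro a b hab
    fin_cases a <;> fin_cases b <;> simp_all [eq_comm]⟩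
  obtain ⟨γ, hγ⟩ := Equiv.Perm.exists_smul_eq_embedding (Fin.castLEEmb hn) y
  have hγ' : ∀ k : Fin 4, γ (Fin.castLE hn k) = y k := fun k => DFunLike.congr_fun hγ k
  have e1 : edge σ i = edge γ ⟨0, by omega⟩ := by
    simp only [edge]
    exact congrArg₂ (fun a b => ({a, b} : Finset (Fin n))) (hγ' 0).symm (hγ' 1).symm
  have e2 : edge σ' j = edge γ ⟨2, by omega⟩ := by
    simp only [edge]
    exact congrArg₂ (fun a b => ({a, b} : Finset (Fin n))) (hγ' 2).symm (hγ' 3).symm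
  rw [e1, e2, crossingOf_edge, crossingOf_edge, ← map_mul, ← map_mul,
    pureCrossing_mul_of_far le_rfl]

/-- Push the permutation through the word from left to right: `τ_i` is absorbed, while `ζ_i = (ζ_i
τ_i) τ_i` leaves a conjugated pure crossing behind. The initial `σ` makes the induction work. -/
theorem ofPerm_mul_wordClass (σ : Equiv.Perm (Fin n)) (w : Word n) :
    ofPerm n σ * wordClass StrongRel w =
      ((edgesFrom σ w).map crossingOf).prod * ofPerm n (σ * strandAt w) := by
  induction w generalizing σ with
  | nil => simp [edgesFrom, wordClass_nil]
  | cons g w ih =>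
    cases g with
    | tau i =>
      rw [wordClass_cons, ← mul_assoc, strandAt_cons, ← mul_assoc, edgesFrom, ← ih, map_mul,
        swap_tau, ofPerm_swap]
      rfl
    | zeta i =>
      rw [wordClass_cons, ← mul_assoc, strandAt_cons, ← mul_assoc, edgesFrom, List.map_cons,
        List.prod_cons, mul_assoc (crossingOf _), ← ih, map_mul, swap_zeta, ofPerm_swap,
        crossingOf_edge, permConj_apply, ← mul_assoc]
      congr 1
      rw [mul_assoc, ← mul_assoc (ofPerm n σ⁻¹), ofPerm_inv_mul_ofPerm, one_mul, pureCrossing,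
        mul_assoc, mul_assoc, tauClass_mul_self, mul_one]
      rfl

theorem wordClass_eq_prod (w : Word n) :
    wordClass StrongRel w = ((edgesFrom 1 w).map crossingOf).prod * ofPerm n (strandAt w) := by
  have h := ofPerm_mul_wordClass 1 w
  rwa [map_one, one_mul, one_mul] at h

theorem exists_of_mem_edgesFrom {σ : Equiv.Perm (Fin n)} {w : Word n} {e : Finset (Fin n)}
    (h : e ∈ edgesFrom σ w) : ∃ σ' i, e = edge σ' i := by
  induction w generalizing σ with
  | nil => simp [edgesFrom] at h
  | cons g w ih =>
    cases g with
    | tau i => exact ih h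
    | zeta i =>
      rcases List.mem_cons.1 h with rfl | h
      · exact ⟨_, _, rfl⟩
      · exact ih h

theorem stronglyEquivalent_of_traceEq {u v : Word n} (hs : strandAt u = strandAt v)
    (he : TraceEq Disjoint (edgesFrom 1 u) (edgesFrom 1 v)) : StronglyEquivalent u v := by
  refine wordClass_eq_iff.1 ?_
  rw [wordClass_eq_prod, wordClass_eq_prod, hs]
  congr 1
  refine (he.prod_map_eq crossingOf fun a ha b hb hab => ?_).1
  obtain ⟨σ, i, rfl⟩ := exists_of_mem_edgesFrom ha
  obtain ⟨σ', j, rfl⟩ := exists_of_mem_edgesFrom hb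
  exact crossingOf_mul_comm hab

/-- The projection from the strong monoid to `F_n`. -/
def strongToF (n : ℕ) : StrongMonoid n →* F n :=
  wordLift (fun g => PresentedGroup.of g) fun _ _ h => toF_eq_of_defRel (.strong h)

theorem strongToF_wordClass (w : Word n) : strongToF n (wordClass StrongRel w) = w.toF :=
  wordLift_wordClass ..

theorem strongToF_crossingOf_mul_self (σ : Equiv.Perm (Fin n)) (i : Fin (n - 1)) :
    strongToF n (crossingOf (edge σ i)) * strongToF n (crossingOf (edge σ i)) = 1 := by
  have hz : strongToF n (zetaClass i) * strongToF n (zetaClass i) = 1 := by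
    rw [← map_mul]
    exact toF_eq_of_defRel (.zeta_sq i)
  have h : strongToF n (pureCrossing i) * strongToF n (pureCrossing i) = 1 := by
    rw [← map_mul, pureCrossing, mul_assoc, ← mul_assoc (tauClass i), tauClass_mul_zetaClass,
      mul_assoc (zetaClass i) (tauClass i), tauClass_mul_self, mul_one, map_mul, hz]
  rw [crossingOf_edge, ← map_mul, ← map_mul, permConj_apply, map_mul, map_mul,
    map_mul (strongToF n) (pureCrossing i), h, mul_one, ← map_mul, ofPerm_mul_ofPerm_inv, map_one]

theorem toF_eq_prod (w : Word n) :
    w.toF = ((edgesFrom 1 w).map fun e => strongToF n (crossingOf e)).prod *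
      strongToF n (ofPerm n (strandAt w)) := by
  rw [← strongToF_wordClass, wordClass_eq_prod, map_mul, map_list_prod, List.map_map]
  rfl

end StrongMonoid

/-! ### Bigons as cancellations, and the conclusion -/

section Bigon

variable {n : ℕ}

theorem crossingStrands_eq_edge (β : Word n) (k : ℕ) (i : Fin (n - 1)) :
    crossingStrands β k i = edge (strandAt (β.take k)) i := rfl

theorem exists_append_of_edgesFrom_eq {σ : Equiv.Perm (Fin n)} {w : Word n}
    {X Y : List (Finset (Fin n))} {e : Finset (Fin n)} (h : edgesFrom σ w = X ++ e :: Y) :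
    ∃ A i B, w = A ++ zeta i :: B ∧ edgesFrom σ A = X ∧ edge (σ * strandAt A) i = e ∧
      edgesFrom (σ * strandAt (A ++ [zeta i])) B = Y := by
  induction w generalizing σ X with
  | nil => simp [edgesFrom] at h
  | cons g w ih =>
    cases g with
    | tau i =>
      obtain ⟨A, j, B, rfl, h1, h2, h3⟩ := ih h
      refine ⟨tau i :: A, j, B, rfl, h1, ?_, ?_⟩
      · rw [strandAt_cons, ← mul_assoc, h2]
      · rw [List.cons_append, strandAt_cons, ← mul_assoc, h3]
    | zeta i =>
      cases X with
      | nil =>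
        obtain ⟨h1, h2⟩ := List.cons.inj h
        refine ⟨[], i, w, rfl, rfl, ?_, ?_⟩
        · rw [strandAt_nil, mul_one]; exact h1
        · rw [List.nil_append, strandAt_cons, strandAt_nil, mul_one]; exact h2
      | cons x X =>
        obtain ⟨h1, h2⟩ := List.cons.inj h
        obtain ⟨A, j, B, rfl, h3, h4, h5⟩ := ih h2
        refine ⟨zeta i :: A, j, B, rfl, ?_, ?_, ?_⟩
        · rw [← h1, ← h3]; rfl
        · rw [strandAt_cons, ← mul_assoc, h4]
        · rw [List.cons_append, strandAt_cons, ← mul_assoc, h5]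

theorem edge_mem_edgesFrom (σ : Equiv.Perm (Fin n)) {w : Word n} {m : ℕ} {t : Fin (n - 1)}
    (h : w[m]? = some (zeta t)) : edge (σ * strandAt (w.take m)) t ∈ edgesFrom σ w := by
  induction w generalizing σ m with
  | nil => simp at h
  | cons g w ih =>
    cases m with
    | zero =>
      obtain rfl : g = zeta t := by simpa using h
      simp [edgesFrom]
    | succ m =>
      have h' := ih (σ * g.swap) (by simpa using h)
      rw [List.take_succ_cons, strandAt_cons, ← mul_assoc]
      cases g with
      | tau i => exact h'
      | zeta i => exact List.mem_cons_of_mem _ h'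

theorem exists_of_edge_mem_edgesFrom {σ : Equiv.Perm (Fin n)} {w : Word n}
    {e : Finset (Fin n)} (h : e ∈ edgesFrom σ w) :
    ∃ m t, w[m]? = some (zeta t) ∧ e = edge (σ * strandAt (w.take m)) t := by
  obtain ⟨X, Y, h⟩ := List.append_of_mem h
  obtain ⟨A, i, B, rfl, -, h2, -⟩ := exists_append_of_edgesFrom_eq h
  exact ⟨A.length, i, by simp, by simp [h2]⟩

theorem eq_append_cons_of_getElem? {α : Type*} {l : List α} {k : ℕ} {a : α}
    (h : l[k]? = some a) : ∃ A B, l = A ++ a :: B ∧ A.length = k := by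
  obtain ⟨hk, rfl⟩ := List.getElem?_eq_some_iff.1 h
  exact ⟨l.take k, l.drop (k + 1), by simp, by simp; omega⟩

theorem take_append_cons_append {α : Type*} (A B C : List α) (a : α) {m : ℕ}
    (hm : m ≤ B.length) :
    (A ++ a :: (B ++ C)).take (A.length + 1 + m) = A ++ a :: B.take m := by
  rw [add_assoc, List.take_length_add_append, add_comm 1 m, List.take_succ_cons,
    List.take_append_of_le_length hm]

theorem getElem?_append_cons_append {α : Type*} (A B C : List α) (a : α) {m : ℕ}
    (hm : m < B.length) : (A ++ a :: (B ++ C))[A.length + 1 + m]? = B[m]? := by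
  rw [List.getElem?_append_right (by omega), show A.length + 1 + m - A.length = m + 1 by omega,
    List.getElem?_cons_succ, List.getElem?_append_left hm]

/-- A bigon in terms of a decomposition of the word. -/
theorem formBigon_append_iff (A B C : Word n) (i j : Fin (n - 1)) :
    FormBigon (A ++ zeta i :: (B ++ zeta j :: C)) A.length (A.length + 1 + B.length) ↔
      edge (strandAt (A ++ zeta i :: B)) j = edge (strandAt A) i ∧
      ∀ f ∈ edgesFrom (strandAt (A ++ [zeta i])) B, Disjoint f (edge (strandAt A) i) := by
  have hk : (A ++ zeta i :: (B ++ zeta j :: C))[A.length]? = some (zeta i) := by simp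
  have hl : (A ++ zeta i :: (B ++ zeta j :: C))[A.length + 1 + B.length]? = some (zeta j) := by
    rw [List.getElem?_append_right (by omega),
      show A.length + 1 + B.length - A.length = B.length + 1 by omega, List.getElem?_cons_succ,
      List.getElem?_append_right le_rfl, Nat.sub_self, List.getElem?_cons_zero]
  have hstrand : ∀ m, strandAt (A ++ zeta i :: B.take m) =
      strandAt (A ++ [zeta i]) * strandAt (B.take m) := fun m => by
    rw [← strandAt_append, List.append_assoc, List.singleton_append]
  have hmid : ∀ m < B.length, ∀ t, crossingStrands (A ++ zeta i :: (B ++ zeta j :: C))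
      (A.length + 1 + m) t = edge (strandAt (A ++ [zeta i]) * strandAt (B.take m)) t := by
    intro m hm t
    rw [crossingStrands_eq_edge, take_append_cons_append _ _ _ _ hm.le, hstrand]
  have hck : ∀ t, crossingStrands (A ++ zeta i :: (B ++ zeta j :: C)) A.length t =
      edge (strandAt A) t := fun t => by rw [crossingStrands_eq_edge, List.take_left]
  have hcl : ∀ t, crossingStrands (A ++ zeta i :: (B ++ zeta j :: C))
      (A.length + 1 + B.length) t = edge (strandAt (A ++ zeta i :: B)) t := fun t => by
    rw [crossingStrands_eq_edge, take_append_cons_append _ _ _ _ le_rfl, List.take_length]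
  constructor
  · rintro ⟨-, i', j', hi, hj, he, hd⟩
    rw [hk] at hi
    rw [hl] at hj
    obtain rfl : i = i' := by simpa using hi
    obtain rfl : j = j' := by simpa using hj
    rw [hck, hcl] at he
    refine ⟨he.symm, fun f hf => ?_⟩
    obtain ⟨m, t, hm, rfl⟩ := exists_of_edge_mem_edgesFrom hf
    obtain ⟨hmB, -⟩ := List.getElem?_eq_some_iff.1 hm
    have h := hd (A.length + 1 + m) (by omega) (by omega) t
      (by rw [getElem?_append_cons_append _ _ _ _ hmB, hm])
    rwa [hmid m hmB, hck] at h
  · rintro ⟨he, hd⟩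
    refine ⟨by omega, i, j, hk, hl, by rw [hck, hcl, he], fun m hkm hml t ht => ?_⟩
    obtain ⟨m, rfl⟩ : ∃ m', m = A.length + 1 + m' := ⟨m - (A.length + 1), by omega⟩
    have hmB : m < B.length := by omega
    rw [getElem?_append_cons_append _ _ _ _ hmB] at ht
    rw [hmid m hmB, hck]
    exact hd _ (edge_mem_edgesFrom _ ht)

theorem exists_append_of_formBigon {β : Word n} {k l : ℕ} (h : FormBigon β k l) :
    ∃ A i B j C, β = A ++ zeta i :: (B ++ zeta j :: C) ∧ A.length = k ∧
      A.length + 1 + B.length = l := by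
  obtain ⟨hkl, i, j, hi, hj, -⟩ := h
  obtain ⟨A, D, rfl, rfl⟩ := eq_append_cons_of_getElem? hi
  obtain ⟨m, rfl⟩ : ∃ m, l = A.length + 1 + m := ⟨l - (A.length + 1), by omega⟩
  rw [List.getElem?_append_right (by omega), show A.length + 1 + m - A.length = m + 1 by omega,
    List.getElem?_cons_succ] at hj
  obtain ⟨B, C, rfl, rfl⟩ := eq_append_cons_of_getElem? hj
  exact ⟨A, i, B, j, C, rfl, rfl, rfl⟩

theorem eraseIdx_eraseIdx_append {α : Type*} (A B C : List α) (a b : α) :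
    ((A ++ a :: (B ++ b :: C)).eraseIdx (A.length + 1 + B.length)).eraseIdx A.length =
      A ++ (B ++ C) := by
  rw [List.eraseIdx_append_of_length_le (by omega),
    show A.length + 1 + B.length - A.length = B.length + 1 by omega, List.eraseIdx_cons_succ,
    List.eraseIdx_append_of_length_le le_rfl, Nat.sub_self, List.eraseIdx_cons_zero,
    List.eraseIdx_append_of_length_le le_rfl, Nat.sub_self, List.eraseIdx_cons_zero]

theorem reduced_edgesFrom_of_irreducibleWord {β : Word n} (h : IrreducibleWord β) :
    Reduced Disjoint (edgesFrom 1 β) := by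
  by_contra hr
  obtain ⟨X, e, Y, Z, hβ, hY⟩ := exists_append_of_not_reduced hr
  obtain ⟨A, i, D, rfl, -, hi, hD⟩ := exists_append_of_edgesFrom_eq hβ
  obtain ⟨B, j, C, rfl, hB, hj, -⟩ := exists_append_of_edgesFrom_eq hD
  rw [one_mul] at hi hB hj
  refine h ⟨_, _, _, (formBigon_append_iff A B C i j).2 ⟨?_, ?_⟩, rfl⟩
  · rw [hi, ← hj, ← strandAt_append]; simp
  · rw [hB, hi]; exact hY

theorem map_swap_eq_self_of_disjoint {α : Type*} [DecidableEq α] {a b : α} {f : Finset α}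
    (h : Disjoint f {a, b}) : f.map (Equiv.swap a b).toEmbedding = f := by
  simp only [Finset.disjoint_insert_right, Finset.disjoint_singleton_right] at h
  have : Finset.image (Equiv.swap a b) f = Finset.image id f :=
    Finset.image_congr fun x hx => Equiv.swap_apply_of_ne_of_ne
      (fun e => h.1 (e ▸ hx)) (fun e => h.2 (e ▸ hx))
  rw [Finset.map_eq_image]
  simpa using this

theorem mul_swap_eq_of_edge_eq {σ σ' : Equiv.Perm (Fin n)} {i j : Fin (n - 1)}
    (h : edge σ i = edge σ' j) :
    σ * Equiv.swap (leftPos i) (rightPos i) =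
      Equiv.swap (σ' (leftPos j)) (σ' (rightPos j)) * σ := by
  rw [Equiv.mul_swap_eq_swap_mul]
  rcases pair_eq_iff.1 h with ⟨h1, h2⟩ | ⟨h1, h2⟩
  · rw [h1, h2]
  · rw [h1, h2, Equiv.swap_comm]

/-- Deleting both crossings exchanges the names of the two strands in between. No classical crossing
there involves them, so the list loses only two equal pairs, which commute past the middle and
square to `1` in `F_n`. -/
theorem toF_append_of_bigon {A B C : Word n} {i j : Fin (n - 1)}
    (h1 : edge (strandAt (A ++ zeta i :: B)) j = edge (strandAt A) i)
    (h2 : ∀ f ∈ edgesFrom (strandAt (A ++ [zeta i])) B, Disjoint f (edge (strandAt A) i)) :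
    Word.toF (A ++ (B ++ C)) = Word.toF (A ++ zeta i :: (B ++ zeta j :: C)) := by
  simp only [strandAt_append, strandAt_cons, strandAt_nil, mul_one] at h1 h2
  have hσ : strandAt A * (zeta i).swap =
      Equiv.swap (strandAt A (leftPos i)) (strandAt A (rightPos i)) * strandAt A :=
    mul_swap_eq_of_edge_eq rfl
  have hB : edgesFrom (strandAt A) B = edgesFrom (strandAt A * (zeta i).swap) B := by
    have h := edgesFrom_mul (Equiv.swap (strandAt A (leftPos i)) (strandAt A (rightPos i)))
      (strandAt A * (zeta i).swap) B
    rw [hσ, ← mul_assoc, Equiv.swap_mul_self, one_mul, ← hσ] at h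
    rw [h]
    conv_rhs => rw [← List.map_id (edgesFrom (strandAt A * (zeta i).swap) B)]
    exact List.map_congr_left fun f hf => map_swap_eq_self_of_disjoint (h2 f hf)
  -- The two deleted transpositions exchange the same pair of strands, so the order below the bigon
  -- is unaffected.
  have hC : strandAt A * (zeta i).swap * strandAt B * (zeta j).swap =
      strandAt A * strandAt B := by
    rw [swap_zeta j, mul_assoc (strandAt A), mul_swap_eq_of_edge_eq h1, ← mul_assoc (strandAt A),
      hσ]
    simp only [← mul_assoc, Equiv.swap_mul_self, one_mul]
  have hstrand : strandAt (A ++ zeta i :: (B ++ zeta j :: C)) = strandAt (A ++ (B ++ C)) := by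
    simp only [strandAt_append, strandAt_cons, ← mul_assoc, hC]
  rw [toF_eq_prod, toF_eq_prod, hstrand]
  congr 1
  simp only [edgesFrom_append, edgesFrom, one_mul, hC, hB, List.map_append, List.map_cons,
    List.prod_append, List.prod_cons]
  congr 1
  rw [mul_assoc (strandAt A), h1]
  have hcomm : Commute (strongToF n (crossingOf (edge (strandAt A) i)))
      ((edgesFrom (strandAt A * (zeta i).swap) B).map
        fun e => strongToF n (crossingOf e)).prod := by
    refine Commute.list_prod_right _ _ fun x hx => ?_
    obtain ⟨f, hf, rfl⟩ := List.mem_map.1 hx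
    have hd := h2 f hf
    obtain ⟨σ', t, rfl⟩ := exists_of_mem_edgesFrom hf
    rw [commute_iff_eq, ← map_mul, ← map_mul, crossingOf_mul_comm hd]
  rw [← mul_assoc, hcomm.eq, mul_assoc, ← mul_assoc (strongToF n _),
    strongToF_crossingOf_mul_self, one_mul]

theorem BigonReduction.toF_eq {β β' : Word n} (h : BigonReduction β β') : β'.toF = β.toF := by
  obtain ⟨k, l, h, rfl⟩ := h
  obtain ⟨A, i, B, j, C, rfl, rfl, rfl⟩ := exists_append_of_formBigon h
  rw [eraseIdx_eraseIdx_append]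
  obtain ⟨h1, h2⟩ := (formBigon_append_iff A B C i j).1 h
  exact toF_append_of_bigon h1 h2

theorem BigonReduction.length_lt {β β' : Word n} (h : BigonReduction β β') :
    β'.length < β.length := by
  obtain ⟨k, l, h, rfl⟩ := h
  obtain ⟨A, i, B, j, C, rfl, rfl, rfl⟩ := exists_append_of_formBigon h
  rw [eraseIdx_eraseIdx_append]
  simp

theorem toF_append (u v : Word n) : Word.toF (u ++ v) = u.toF * v.toF := by
  simp [Word.toF]

theorem toF_reverse_mul_toF (w : Word n) : Word.toF w.reverse * w.toF = 1 := by
  induction w with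
  | nil => simp [Word.toF]
  | cons g w ih =>
    have hg : Word.toF [g, g] = 1 := by
      cases g with
      | tau i => exact toF_eq_of_defRel (.strong (.tau_sq i))
      | zeta i => exact toF_eq_of_defRel (.zeta_sq i)
    rw [← toF_append, List.reverse_cons,
      show w.reverse ++ [g] ++ g :: w = w.reverse ++ ([g, g] ++ w) by simp, toF_append,
      toF_append, hg, one_mul, ih]

/-- All letters are involutions, so reversing a word inverts its element and no formal inverses are
needed. -/
theorem exists_word_toF_eq (b : F n) : ∃ β : Word n, β.toF = b := by
  let H : Subgroup (F n) :=
    { carrier := {x | ∃ β : Word n, β.toF = x}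
      one_mem' := ⟨[], rfl⟩
      mul_mem' := by
        rintro _ _ ⟨u, rfl⟩ ⟨v, rfl⟩
        exact ⟨u ++ v, toF_append u v⟩
      inv_mem' := by
        rintro _ ⟨u, rfl⟩
        exact ⟨u.reverse, eq_inv_of_mul_eq_one_left (toF_reverse_mul_toF u)⟩ }
  exact PresentedGroup.generated_by _ H (fun g => ⟨[g], by simp [Word.toF]⟩) b

theorem exists_irreducibleWord_toF_eq (b : F n) :
    ∃ β : Word n, β.toF = b ∧ IrreducibleWord β := by
  obtain ⟨β, hβ⟩ := exists_word_toF_eq b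
  induction hl : β.length using Nat.strong_induction_on generalizing β with
  | _ l ih =>
    by_cases hirr : IrreducibleWord β
    · exact ⟨β, hβ, hirr⟩
    · obtain ⟨β', h⟩ := not_not.1 hirr
      exact ih _ (hl ▸ h.length_lt) β' (h.toF_eq.trans hβ) rfl

theorem stronglyEquivalent_of_toF_eq {β β' : Word n} (h : β.toF = β'.toF)
    (hβ : IrreducibleWord β) (hβ' : IrreducibleWord β') : StronglyEquivalent β β' := by
  refine stronglyEquivalent_of_traceEq (strandAt_eq_of_toF_eq h) ?_
  have h' := normalize_edgesFrom_traceEq_of_toF_eq h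
  rwa [(reduced_edgesFrom_of_irreducibleWord hβ).normalize_eq,
    (reduced_edgesFrom_of_irreducibleWord hβ').normalize_eq] at h'

end Bigon

end FreeBraid

theorem mainTheorem3 (n : ℕ) (b : FreeBraid.F n) :
    (∃ β₀ : FreeBraid.Word n, β₀.toF = b ∧ FreeBraid.IrreducibleWord β₀) ∧
    (∀ β β' : FreeBraid.Word n, β.toF = b → β'.toF = b →
      FreeBraid.IrreducibleWord β → FreeBraid.IrreducibleWord β' →
      FreeBraid.StronglyEquivalent β β') :=
  ⟨FreeBraid.exists_irreducibleWord_toF_eq b, fun _ _ h h' hβ hβ' =>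
    FreeBraid.stronglyEquivalent_of_toF_eq (h.trans h'.symm) hβ hβ'⟩
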